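/- Fix a finite $n>0$. Formulas are built from letters $p_0,p_1,\dots$ by $\to,\bot,\Diamond_i$ ($i<n$), with $\Box_i=\neg\Diamond_i\neg$ and the other Boolean connectives as usual abbreviations. A logic is a set of formulas that contains the classical tautologies, $\Diamond_i(p\vee q)\to\Diamond_ip\vee\Diamond_iq$ and $\neg\Diamond_i\bot$ ($i<n$), and is closed under modus ponens, substitution and monotonicity ($\varphi\to\psi\,/\,\Diamond_i\varphi\to\Diamond_i\psi$); $L\vdash\varphi$ means $\varphi\in L$. Put $\Diamond^0\varphi=\varphi$, $\Diamond^{m+1}\varphi=\Diamond^m(\Diamond_0\varphi\vee\dots\vee\Diamond_{n-1}\varphi)$, $\Diamond^{\le m}\varphi=\bigvee_{l\le m}\Diamond^l\varphi$. A logic $L$ is pretransitive if $L\vdash\Diamond^{m+1}p\to\Diamond^{\le m}p$ for some $m\ge 0$; for the least such $m$, write $\Diamond^*\varphi=\Diamond^{\le m}\varphi$ and $\Box^*\varphi=\neg\Diamond^*\neg\varphi$. Let $B_0=\bot$, $B_{i+1}=p_{i+1}\to\Box^*(\Diamond^*p_{i+1}\vee B_i)$, and let $L[h]$ be the smallest logic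 containing $L\cup\{B_h\}$. A $k$-formula is a formula in the letters $p_i$, $i<k$. A logic is $k$-tabular if there are only finitely many $k$-formulas up to equivalence in it. The $k$-canonical frame of $L$ consists of the maximal $L$-consistent sets $x$ of $k$-formulas, with $xR_iy$ iff $\Diamond_i\varphi\in x$ for all $\varphi\in y$. With $R=\bigcup_{i<n}R_i$ and $R^*$ its reflexive transitive closure, the depth of $x$ is the supremum of the cardinalities of chains in the poset of clusters ($R^*\cap (R^*)^{-1}$-classes, ordered by $R^*$) of the frame restricted to $R^*(x)=\{y\mid xR^*y\}$. **Theorem.** Let $L$ be a pretransitive logic and let $h,k<\omega$ be such that $L[h]$ is $k$-tabular. Then for each $i\le h$ there is a $k$-formula $\mathbf B_{i,k}$ such that, for all $x$ in the $k$-canonical frame of $L$, $\mathbf B_{i,k}\in x$ iff the depth of $x$ is at most $i$. Moreover, for any such formulas $\mathbf B_{0,k},\dots,\mathbf B_{h,k}$ and every $k$-formula $\varphi$, $$L[h+1]\vdash\varphi\quad\Longleftrightarrow\quad L\vdash\bigwedge_{i\le h}\bigl(\Box^*(\Box^*\varphi\to\mathbf B_{i,k})\to\mathbf B_{i,k}\bigr).$$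 -/

import Mathlib

/-- `n`-modal formulas over the proposition letters `p_0, p_1, …`. -/
inductive Formula (n : ℕ) : Type
  | var : ℕ → Formula n
  | bot : Formula n
  | imp : Formula n → Formula n → Formula n
  | dia : Fin n → Formula n → Formula n

namespace Formula

variable {n : ℕ}

def neg (φ : Formula n) : Formula n := imp φ bot

def or (φ ψ : Formula n) : Formula n := imp (neg φ) ψ

def and (φ ψ : Formula n) : Formula n := neg (imp φ (neg ψ))

def iff (φ ψ : Formula n) : Formula n := and (imp φ ψ) (imp ψ φ)

/-- Finite disjunction; the empty disjunction is `⊥`. -/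
def bigOr (l : List (Formula n)) : Formula n := l.foldr or bot

/-- Finite conjunction; the empty conjunction is `⊤ = ¬⊥`. -/
def bigAnd (l : List (Formula n)) : Formula n := l.foldr and (neg bot)

/-- Uniform substitution of formulas for proposition letters. -/
def subst (s : ℕ → Formula n) : Formula n → Formula n
  | var p => s p
  | bot => bot
  | imp φ ψ => imp (subst s φ) (subst s ψ)
  | dia i φ => dia i (subst s φ)

/-- Classical truth value, the letters and the formulas `◇_i φ` being treated as atoms
whose truth values are given by `v`. -/
def eval (v : Formula n → Prop) : Formula n → Prop
  | var p => v (var p)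
  | bot => False
  | imp φ ψ => eval v φ → eval v ψ
  | dia i φ => v (dia i φ)

/-- Classical tautologies (in the modal language). -/
def IsTautology (φ : Formula n) : Prop := ∀ v : Formula n → Prop, eval v φ

/-- `k`-formulas: all proposition letters are among `p_0, …, p_{k-1}`. -/
def IsKFormula (k : ℕ) : Formula n → Prop
  | var p => p < k
  | bot => True
  | imp φ ψ => IsKFormula k φ ∧ IsKFormula k ψ
  | dia _ φ => IsKFormula k φ

/-- `◇_0 φ ∨ … ∨ ◇_{n-1} φ`. -/
def diaAny (φ : Formula n) : Formula n := bigOr ((List.finRange n).map fun i => dia i φ)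

/-- `◇^0 φ = φ`, `◇^{m+1} φ = ◇^m (◇_0 φ ∨ … ∨ ◇_{n-1} φ)`. -/
def diaPow : ℕ → Formula n → Formula n
  | 0, φ => φ
  | m + 1, φ => diaPow m (diaAny φ)

/-- `◇^{≤m} φ = ⋁_{l ≤ m} ◇^l φ`. -/
def diaLe (m : ℕ) (φ : Formula n) : Formula n :=
  bigOr ((List.range (m + 1)).map fun l => diaPow l φ)

/-- `□^{≤m} φ = ¬ ◇^{≤m} ¬ φ`. -/
def boxLe (m : ℕ) (φ : Formula n) : Formula n := neg (diaLe m (neg φ))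

end Formula

/-- Propositional normal `n`-modal logics. -/
structure IsLogic {n : ℕ} (L : Set (Formula n)) : Prop where
  taut : ∀ φ : Formula n, φ.IsTautology → φ ∈ L
  dia_or : ∀ i : Fin n,
    Formula.imp (.dia i (.or (.var 0) (.var 1))) (.or (.dia i (.var 0)) (.dia i (.var 1))) ∈ L
  dia_bot : ∀ i : Fin n, Formula.neg (.dia i .bot) ∈ L
  mp : ∀ φ ψ : Formula n, Formula.imp φ ψ ∈ L → φ ∈ L → ψ ∈ L
  subst : ∀ (s : ℕ → Formula n) (φ : Formula n), φ ∈ L → φ.subst s ∈ L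
  mono : ∀ (i : Fin n) (φ ψ : Formula n),
    Formula.imp φ ψ ∈ L → Formula.imp (.dia i φ) (.dia i ψ) ∈ L

namespace ModalLogic

variable {n : ℕ}

/-- `L + Ψ`: the smallest logic containing `L ∪ Ψ`. -/
def extendBy (L Ψ : Set (Formula n)) : Set (Formula n) := ⋂₀ {L' | IsLogic L' ∧ L ∪ Ψ ⊆ L'}

theorem isLogic_extendBy (L Ψ : Set (Formula n)) : IsLogic (extendBy L Ψ) where
  taut φ h := fun _ hL' => hL'.1.taut φ h
  dia_or i := fun _ hL' => hL'.1.dia_or i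
  dia_bot i := fun _ hL' => hL'.1.dia_bot i
  mp φ ψ h₁ h₂ := fun L' hL' => hL'.1.mp φ ψ (h₁ L' hL') (h₂ L' hL')
  subst s φ h := fun L' hL' => hL'.1.subst s φ (h L' hL')
  mono i φ ψ h := fun L' hL' => hL'.1.mono i φ ψ (h L' hL')

/-- `L` is `m`-transitive: `L ⊢ ◇^{m+1} p → ◇^{≤m} p`. -/
def IsMTransitive (L : Set (Formula n)) (m : ℕ) : Prop :=
  Formula.imp (.diaPow (m + 1) (.var 0)) (.diaLe m (.var 0)) ∈ L

def IsPretransitive (L : Set (Formula n)) : Prop := ∃ m, IsMTransitive L m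

/-- The least `m` such that `L` is `m`-transitive (meaningful for pretransitive `L`). -/
noncomputable def transIndex (L : Set (Formula n)) : ℕ := sInf {m | IsMTransitive L m}

/-- `◇* φ`, with respect to the pretransitive logic `L`. -/
noncomputable def diaStar (L : Set (Formula n)) (φ : Formula n) : Formula n :=
  .diaLe (transIndex L) φ

/-- `□* φ`, with respect to the pretransitive logic `L`. -/
noncomputable def boxStar (L : Set (Formula n)) (φ : Formula n) : Formula n :=
  .boxLe (transIndex L) φ

/-- `B_0 = ⊥`, `B_{i+1} = p_{i+1} → □*(◇* p_{i+1} ∨ B_i)`. -/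
noncomputable def heightFormula (L : Set (Formula n)) : ℕ → Formula n
  | 0 => .bot
  | i + 1 => .imp (.var (i + 1))
      (boxStar L (.or (diaStar L (.var (i + 1))) (heightFormula L i)))

/-- `L[h] = L + B_h`. -/
noncomputable def ofHeight (L : Set (Formula n)) (h : ℕ) : Set (Formula n) :=
  extendBy L {heightFormula L h}

/-- `L` is `k`-tabular: up to equivalence in `L` there are only finitely many `k`-formulas. -/
def IsKTabular (L : Set (Formula n)) (k : ℕ) : Prop :=
  ∃ S : Set (Formula n), S.Finite ∧ (∀ ψ ∈ S, ψ.IsKFormula k) ∧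
    ∀ φ : Formula n, φ.IsKFormula k → ∃ ψ ∈ S, Formula.iff φ ψ ∈ L

/-- `Γ` is `L`-consistent: no finite conjunction of its members is refutable in `L`. -/
def IsConsistentSet (L Γ : Set (Formula n)) : Prop :=
  ∀ l : List (Formula n), (∀ ψ ∈ l, ψ ∈ Γ) → Formula.neg (.bigAnd l) ∉ L

/-- Maximal `L`-consistent sets of `k`-formulas. -/
def IsMaxConsistent (L : Set (Formula n)) (k : ℕ) (x : Set (Formula n)) : Prop :=
  Maximal (fun Γ : Set (Formula n) => (∀ ψ ∈ Γ, ψ.IsKFormula k) ∧ IsConsistentSet L Γ) x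

end ModalLogic

/-- Kripke frames with `n` relations. The domain may be empty, so that the canonical frame
makes sense for the inconsistent logic too. -/
structure KripkeFrame (n : ℕ) where
  W : Type
  R : Fin n → W → W → Prop

namespace KripkeFrame

variable {n : ℕ}

/-- `R_F = ⋃_i R_i`. -/
def rel (F : KripkeFrame n) (x y : F.W) : Prop := ∃ i, F.R i x y

/-- `R_F^*`, the reflexive transitive closure of `R_F`. -/
def relStar (F : KripkeFrame n) : F.W → F.W → Prop := Relation.ReflTransGen F.rel

/-- The preorder `(W, R_F^*)`. -/
abbrev toPreorder (F : KripkeFrame n) : Preorder F.W where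
  le := F.relStar
  le_refl _ := Relation.ReflTransGen.refl
  le_trans _ _ _ := Relation.ReflTransGen.trans

/-- The restriction of `F` onto `V`. -/
def restrict (F : KripkeFrame n) (V : Set F.W) : KripkeFrame n where
  W := V
  R i x y := F.R i x y

/-- The restriction of `F` onto `R_F^*(x)`. -/
def cone (F : KripkeFrame n) (x : F.W) : KripkeFrame n := F.restrict {y | F.relStar x y}

/-- The height of `F`: the supremum in `ℕ∞` of the cardinalities of the chains in the skeleton
of `F`, i.e. in the poset of clusters of `F`. -/
noncomputable def height (F : KripkeFrame n) : ℕ∞ :=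
  letI : Preorder F.W := F.toPreorder
  (Set.univ : Set (Antisymmetrization F.W (· ≤ ·))).chainHeight (· ≤ ·)

/-- The depth of `x` in `F`. -/
noncomputable def depth (F : KripkeFrame n) (x : F.W) : ℕ∞ := (F.cone x).height

end KripkeFrame

namespace ModalLogic

variable {n : ℕ}

/-- The `k`-canonical frame of `L`. -/
def canonicalFrame (L : Set (Formula n)) (k : ℕ) : KripkeFrame n where
  W := {x : Set (Formula n) // IsMaxConsistent L k x}
  R i x y := ∀ φ, φ ∈ y.1 → Formula.dia i φ ∈ x.1

/-- `B 0, …, B h` are `k`-formulas `B_{0,k}, …, B_{h,k}` defining depth in the `k`-canonical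
frame of `L`: `B_{i,k} ∈ x` iff the depth of `x` is at most `i`. -/
def DefinesDepth (L : Set (Formula n)) (h k : ℕ) (B : ℕ → Formula n) : Prop :=
  ∀ i ≤ h, (B i).IsKFormula k ∧
    ∀ x : (canonicalFrame L k).W, B i ∈ x.1 ↔ (canonicalFrame L k).depth x ≤ (i : ℕ∞)

/-- `⋀_{i ≤ h} (□*(□* φ → B_i) → B_i)`. -/
noncomputable def translation (L : Set (Formula n)) (h : ℕ) (B : ℕ → Formula n)
    (φ : Formula n) : Formula n :=
  .bigAnd ((List.range (h + 1)).map fun i =>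
    .imp (boxStar L (.imp (boxStar L φ) (B i))) (B i))

end ModalLogic

/-! ### Chains in a preorder -/

section Preorder

variable {α : Type*} [Preorder α]

/-- Every strictly increasing sequence starting at `x` has at most `j` members. -/
def DepthLE : ℕ → α → Prop
  | 0, _ => False
  | j + 1, x => ∀ z, x < z → DepthLE j z

theorem chainHeight_Ici_le_iff (j : ℕ) (x : α) :
    (Set.Ici x).chainHeight (· < ·) ≤ (j : ℕ∞) ↔ DepthLE j x := by
  induction j generalizing x with
  | zero => simp [DepthLE, Set.nonempty_Ici.ne_empty]
  | succ j ih =>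
    simp only [DepthLE]
    constructor
    · intro h z hz
      rw [← ih]
      refine iSup_le fun ⟨t, ht, hc⟩ => ?_
      have hx : ∀ y ∈ t, x < y := fun y hy => hz.trans_le (ht hy)
      have hchain : IsChain (· < ·) (insert x t) := hc.insert fun b hb _ => Or.inl (hx b hb)
      have hsub : insert x t ⊆ Set.Ici x :=
        Set.insert_subset (Set.mem_Ici.2 le_rfl) fun y hy => (hx y hy).le
      have hle := (Set.encard_le_chainHeight_of_isChain _ _ hsub hchain).trans h
      rw [Set.encard_insert_of_notMem fun hxt => lt_irrefl _ (hx x hxt)] at hle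
      push_cast at hle
      exact (ENat.add_le_add_iff_right (by simp)).1 hle
    · intro h
      refine iSup_le fun ⟨t, ht, hc⟩ => ?_
      have hone : {y ∈ t | y ≤ x}.encard ≤ 1 := by
        refine Set.encard_le_one_iff.2 fun a b ha hb => ?_
        by_contra hne
        rcases hc ha.1 hb.1 hne with hab | hab
        · exact absurd (hb.2.trans (ht ha.1)) hab.not_ge
        · exact absurd (ha.2.trans (ht hb.1)) hab.not_ge
      have hrest : {y ∈ t | ¬ y ≤ x}.encard ≤ j := by
        by_contra hlt
        obtain ⟨u, hu, hcard⟩ := Set.exists_subset_encard_eq (k := ((j + 1 : ℕ) : ℕ∞))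
          (s := {y ∈ t | ¬ y ≤ x}) (by simpa using Order.add_one_le_of_lt (not_le.1 hlt))
        have hfin : u.Finite := Set.finite_of_encard_eq_coe hcard
        have hne : u.Nonempty := by
          rw [← Set.encard_ne_zero, hcard]; simp
        obtain ⟨z, hz⟩ := hfin.exists_minimal hne
        have huc : IsChain (· < ·) u := hc.mono fun y hy => (hu hy).1
        have hsub : u ⊆ Set.Ici z := fun y hy => by
          by_cases hyz : z = y
          · exact hyz.le
          rcases huc hz.1 hy hyz with h' | h'
          · exact h'.le
          · exact hz.2 hy h'.le
        have hle := (Set.encard_le_chainHeight_of_isChain _ _ hsub huc).trans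
          ((ih z).2 (h z (lt_of_le_not_ge (ht (hu hz.1).1) (hu hz.1).2)))
        rw [hcard] at hle
        exact absurd (Nat.cast_le.1 hle) (by simp)
      have hunion : t = {y ∈ t | ¬ y ≤ x} ∪ {y ∈ t | y ≤ x} := by
        ext y; by_cases hy : y ≤ x <;> simp [hy]
      change t.encard ≤ _
      rw [hunion]
      push_cast
      exact (Set.encard_union_le _ _).trans (add_le_add hrest hone)

/-- The supremum of the cardinalities of the chains in the poset of clusters of a preorder. -/
noncomputable def skeletonHeight (α : Type*) [Preorder α] : ℕ∞ :=
  (Set.univ : Set (Antisymmetrization α (· ≤ ·))).chainHeight (· ≤ ·)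

theorem skeletonHeight_Ici (x : α) :
    skeletonHeight (Set.Ici x) = (Set.Ici x).chainHeight (· < ·) := by
  apply le_antisymm
  · refine iSup_le fun ⟨t, _, hc⟩ => ?_
    let f : Antisymmetrization (Set.Ici x) (· ≤ ·) → α := fun a =>
      (ofAntisymmetrization (· ≤ ·) a).1
    have hlt : ∀ a b, a ≠ b → a ≤ b → f a < f b := fun a b hne hab => by
      have := lt_of_le_of_ne hab hne
      exact (ofAntisymmetrization_lt_ofAntisymmetrization_iff.2 this)
    have hinj : Set.InjOn f t := fun a ha b hb hab => by
      by_contra hne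
      rcases hc ha hb hne with h | h
      · exact (hlt a b hne h).ne hab
      · exact (hlt b a (Ne.symm hne) h).ne hab.symm
    change t.encard ≤ _
    rw [← hinj.encard_image]
    refine Set.encard_le_chainHeight_of_isChain _ _ ?_ ?_
    · rintro _ ⟨a, _, rfl⟩
      exact (ofAntisymmetrization (· ≤ ·) a).2
    · rintro _ ⟨a, ha, rfl⟩ _ ⟨b, hb, rfl⟩ hne
      have hab : a ≠ b := fun h => hne (h ▸ rfl)
      exact (hc ha hb hab).imp (hlt a b hab) (hlt b a hab.symm)
  · refine iSup_le fun ⟨t, ht, hc⟩ => ?_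
    let g : t → Antisymmetrization (Set.Ici x) (· ≤ ·) := fun a =>
      toAntisymmetrization (· ≤ ·) ⟨a.1, ht a.2⟩
    have hlt : ∀ a b : t, a.1 < b.1 → g a < g b := fun a b h =>
      toAntisymmetrization_lt_toAntisymmetrization_iff.2 h
    have hcmp : ∀ a b : t, a ≠ b → g a < g b ∨ g b < g a := fun a b hne =>
      (hc a.2 b.2 fun h => hne (Subtype.ext h)).imp (hlt a b) (hlt b a)
    have hinj : Function.Injective g := fun a b hab => by
      by_contra hne
      rcases hcmp a b hne with h | h
      · exact h.ne hab
      · exact h.ne hab.symm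
    have hcard : (Set.range g).encard = t.encard := by
      rw [← Set.image_univ, hinj.encard_image, Set.encard_univ]
      rfl
    change t.encard ≤ _
    rw [← hcard]
    refine Set.encard_le_chainHeight_of_isChain _ _ (Set.subset_univ _) ?_
    rintro _ ⟨a, rfl⟩ _ ⟨b, rfl⟩ hne
    exact (hcmp a b fun h => hne (h ▸ rfl)).imp le_of_lt le_of_lt

end Preorder

namespace KripkeFrame

variable {n : ℕ} (F : KripkeFrame n)

theorem relStar_cone_iff (x : F.W) (y z : (F.cone x).W) :
    (F.cone x).relStar y z ↔ F.relStar y.1 z.1 := by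
  constructor
  · intro h
    induction h with
    | refl => exact Relation.ReflTransGen.refl
    | tail _ hbc ih => exact ih.tail hbc
  · obtain ⟨z, hz⟩ := z
    intro h
    change F.relStar y.1 z at h
    induction h with
    | refl => exact Relation.ReflTransGen.refl
    | tail hyb hbc ih => exact (ih (y.2.trans hyb)).tail hbc

theorem depth_le_iff (x : F.W) (j : ℕ) :
    F.depth x ≤ (j : ℕ∞) ↔ @DepthLE F.W F.toPreorder j x := by
  let _ := F.toPreorder
  rw [← chainHeight_Ici_le_iff, ← skeletonHeight_Ici]
  have h : (F.cone x).toPreorder = (inferInstance : Preorder (Set.Ici x)) :=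
    Preorder.ext fun y z => F.relStar_cone_iff x y z
  exact iff_of_eq (congrArg (fun P => @skeletonHeight (Set.Ici x) P ≤ (j : ℕ∞)) h)

theorem not_depth_le_zero (x : F.W) : ¬ F.depth x ≤ ((0 : ℕ) : ℕ∞) := fun h =>
  (F.depth_le_iff x 0).1 h

theorem depth_le_succ_iff (x : F.W) (j : ℕ) :
    F.depth x ≤ ((j + 1 : ℕ) : ℕ∞) ↔
      ∀ z, F.relStar x z → ¬ F.relStar z x → F.depth z ≤ (j : ℕ∞) := by
  simp only [depth_le_iff]
  exact ⟨fun h z h₁ h₂ => h z ⟨h₁, h₂⟩, fun h z hz => h z hz.1 hz.2⟩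

/-- `y` can be reached from `x` by exactly `m` steps of `R_F`. -/
def relPow : ℕ → F.W → F.W → Prop
  | 0, x, y => x = y
  | m + 1, x, y => ∃ z, relPow m x z ∧ F.rel z y

variable {F}

theorem depth_mono {x y : F.W} (hxy : F.relStar x y) {i : ℕ}
    (hx : F.depth x ≤ (i : ℕ∞)) : F.depth y ≤ (i : ℕ∞) := by
  cases i with
  | zero => exact absurd hx (F.not_depth_le_zero x)
  | succ i =>
    rw [F.depth_le_succ_iff] at hx ⊢
    exact fun z hyz hzy => hx z (hxy.trans hyz) fun hzx => hzy (hzx.trans hxy)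

theorem relPow.relStar {m : ℕ} {x y : F.W} (h : F.relPow m x y) : F.relStar x y := by
  induction m generalizing y with
  | zero => exact h ▸ Relation.ReflTransGen.refl
  | succ m ih =>
    obtain ⟨z, hz, hzy⟩ := h
    exact (ih hz).tail hzy

theorem relPow.head {m : ℕ} {x y z : F.W} (hxz : F.rel x z) (h : F.relPow m z y) :
    F.relPow (m + 1) x y := by
  induction m generalizing y with
  | zero => exact ⟨x, rfl, show F.rel x y from (show z = y from h) ▸ hxz⟩
  | succ m ih =>
    obtain ⟨w, hw, hwy⟩ := h
    exact ⟨w, ih hw, hwy⟩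

end KripkeFrame

/-! ### Syntax -/

namespace Formula

variable {n : ℕ}

section Eval

variable (v : Formula n → Prop) (φ ψ : Formula n) (l : List (Formula n))

@[simp] theorem eval_bot : eval v bot ↔ False := Iff.rfl

@[simp] theorem eval_imp : eval v (imp φ ψ) ↔ (eval v φ → eval v ψ) := Iff.rfl

@[simp] theorem eval_neg : eval v (neg φ) ↔ ¬ eval v φ := Iff.rfl

@[simp] theorem eval_or : eval v (or φ ψ) ↔ eval v φ ∨ eval v ψ := by
  simp only [or, eval_imp, eval_neg]; tauto

@[simp] theorem eval_and : eval v (and φ ψ) ↔ eval v φ ∧ eval v ψ := by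
  simp only [and, eval_imp, eval_neg]; tauto

@[simp] theorem eval_iff : eval v (iff φ ψ) ↔ (eval v φ ↔ eval v ψ) := by
  simp only [iff, eval_imp, eval_and]; tauto

@[simp] theorem eval_bigAnd : eval v (bigAnd l) ↔ ∀ χ ∈ l, eval v χ := by
  induction l with
  | nil => simp [bigAnd]
  | cons χ l ih =>
    change eval v (and χ (bigAnd l)) ↔ _
    simp [ih]

end Eval

section KFormula

variable {k : ℕ} {φ ψ : Formula n} {l : List (Formula n)}

@[simp] theorem isKFormula_bot : (bot : Formula n).IsKFormula k := trivial

@[simp] theorem isKFormula_imp : (imp φ ψ).IsKFormula k ↔ φ.IsKFormula k ∧ ψ.IsKFormula k :=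
  Iff.rfl

@[simp] theorem isKFormula_dia {i : Fin n} : (dia i φ).IsKFormula k ↔ φ.IsKFormula k := Iff.rfl

@[simp] theorem isKFormula_neg : (neg φ).IsKFormula k ↔ φ.IsKFormula k := by simp [neg]

@[simp] theorem isKFormula_or : (or φ ψ).IsKFormula k ↔ φ.IsKFormula k ∧ ψ.IsKFormula k := by
  simp [or]

@[simp] theorem isKFormula_and : (and φ ψ).IsKFormula k ↔ φ.IsKFormula k ∧ ψ.IsKFormula k := by
  simp [and]

@[simp] theorem isKFormula_iff : (iff φ ψ).IsKFormula k ↔ φ.IsKFormula k ∧ ψ.IsKFormula k := by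
  simp [iff]; tauto

@[simp] theorem isKFormula_bigOr : (bigOr l).IsKFormula k ↔ ∀ χ ∈ l, χ.IsKFormula k := by
  induction l with
  | nil => simp [bigOr]
  | cons χ l ih =>
    change (or χ (bigOr l)).IsKFormula k ↔ _
    simp [ih]

@[simp] theorem isKFormula_bigAnd : (bigAnd l).IsKFormula k ↔ ∀ χ ∈ l, χ.IsKFormula k := by
  induction l with
  | nil => simp [bigAnd]
  | cons χ l ih =>
    change (and χ (bigAnd l)).IsKFormula k ↔ _
    simp [ih]

theorem IsKFormula.diaAny (h : φ.IsKFormula k) : (diaAny φ).IsKFormula k := by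
  simp [Formula.diaAny, h]

theorem IsKFormula.diaPow (m : ℕ) (h : φ.IsKFormula k) : (diaPow m φ).IsKFormula k := by
  induction m generalizing φ with
  | zero => exact h
  | succ m ih => exact ih h.diaAny

theorem IsKFormula.diaLe (m : ℕ) (h : φ.IsKFormula k) : (diaLe m φ).IsKFormula k := by
  simp only [Formula.diaLe, isKFormula_bigOr, List.mem_map]
  rintro _ ⟨l, _, rfl⟩
  exact h.diaPow l

theorem IsKFormula.boxLe (m : ℕ) (h : φ.IsKFormula k) : (boxLe m φ).IsKFormula k :=
  isKFormula_neg.2 (IsKFormula.diaLe m (isKFormula_neg.2 h))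

theorem IsKFormula.mono {k' : ℕ} (hk : k ≤ k') (h : φ.IsKFormula k) : φ.IsKFormula k' := by
  induction φ with
  | var p => exact lt_of_lt_of_le (show p < k from h) hk
  | bot => trivial
  | imp φ ψ ih₁ ih₂ => exact ⟨ih₁ h.1, ih₂ h.2⟩
  | dia i φ ih => exact ih h

theorem IsKFormula.subst (s : ℕ → Formula n) (hs : ∀ p, (s p).IsKFormula k) (φ : Formula n) :
    (φ.subst s).IsKFormula k := by
  induction φ with
  | var p => exact hs p
  | bot => trivial
  | imp φ ψ ih₁ ih₂ => exact ⟨ih₁, ih₂⟩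
  | dia i φ ih => exact ih

theorem IsKFormula.subst_congr {s t : ℕ → Formula n} (hst : ∀ p < k, s p = t p)
    (h : φ.IsKFormula k) : φ.subst s = φ.subst t := by
  induction φ with
  | var p => exact hst p h
  | bot => rfl
  | imp φ ψ ih₁ ih₂ => simp only [Formula.subst, ih₁ h.1, ih₂ h.2]
  | dia i φ ih => simp only [Formula.subst, ih h]

end KFormula

section Subst

variable (s : ℕ → Formula n) (φ ψ : Formula n)

@[simp] theorem subst_bot : (bot : Formula n).subst s = bot := rfl

@[simp] theorem subst_imp : (imp φ ψ).subst s = imp (φ.subst s) (ψ.subst s) := rfl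

@[simp] theorem subst_dia (i : Fin n) : (dia i φ).subst s = dia i (φ.subst s) := rfl

@[simp] theorem subst_neg : (neg φ).subst s = neg (φ.subst s) := rfl

@[simp] theorem subst_or : (or φ ψ).subst s = or (φ.subst s) (ψ.subst s) := rfl

theorem subst_bigOr (l : List (Formula n)) :
    (bigOr l).subst s = bigOr (l.map fun χ => χ.subst s) := by
  induction l with
  | nil => rfl
  | cons χ l ih =>
    change (or χ (bigOr l)).subst s = or (χ.subst s) (bigOr _)
    rw [subst_or, ih]

@[simp] theorem subst_diaAny : (diaAny φ).subst s = diaAny (φ.subst s) := by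
  simp [diaAny, subst_bigOr, Function.comp_def]

@[simp] theorem subst_diaPow (m : ℕ) : (diaPow m φ).subst s = diaPow m (φ.subst s) := by
  induction m generalizing φ with
  | zero => rfl
  | succ m ih => simp [diaPow, ih]

@[simp] theorem subst_diaLe (m : ℕ) : (diaLe m φ).subst s = diaLe m (φ.subst s) := by
  simp [diaLe, subst_bigOr, Function.comp_def]

@[simp] theorem subst_boxLe (m : ℕ) : (boxLe m φ).subst s = boxLe m (φ.subst s) := by
  simp [boxLe]

theorem subst_subst (t : ℕ → Formula n) :
    (φ.subst s).subst t = φ.subst fun p => (s p).subst t := by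
  induction φ with
  | var p => rfl
  | bot => rfl
  | imp φ ψ ih₁ ih₂ => simp [ih₁, ih₂]
  | dia i φ ih => simp [ih]

theorem subst_eq_self {k : ℕ} {φ : Formula n} (hφ : φ.IsKFormula k)
    (hs : ∀ p < k, s p = var p) : φ.subst s = φ := by
  induction φ with
  | var p => exact hs p hφ
  | bot => rfl
  | imp φ ψ ih₁ ih₂ => simp [ih₁ hφ.1, ih₂ hφ.2]
  | dia i φ ih => simp [ih hφ]

end Subst

end Formula

namespace IsLogic

variable {n : ℕ} {L : Set (Formula n)} {φ ψ χ : Formula n}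

theorem of_eval₁ (hL : IsLogic L) (h : φ ∈ L)
    (ht : ∀ v : Formula n → Prop, φ.eval v → ψ.eval v) : ψ ∈ L :=
  hL.mp φ ψ (hL.taut _ ht) h

theorem of_eval₂ (hL : IsLogic L) (h₁ : φ ∈ L) (h₂ : ψ ∈ L)
    (ht : ∀ v : Formula n → Prop, φ.eval v → ψ.eval v → χ.eval v) : χ ∈ L :=
  hL.mp ψ χ (hL.mp φ _ (hL.taut _ ht) h₁) h₂

theorem bigAnd_mem (hL : IsLogic L) {l : List (Formula n)} (h : ∀ χ ∈ l, χ ∈ L) :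
    .bigAnd l ∈ L := by
  induction l with
  | nil => exact hL.taut _ fun v => by simp
  | cons χ l ih =>
    simp only [List.mem_cons, forall_eq_or_imp] at h
    exact hL.of_eval₂ h.1 (ih h.2) fun v => by simp; tauto

theorem dia_or_mem (hL : IsLogic L) (i : Fin n) (φ ψ : Formula n) :
    .imp (.dia i (.or φ ψ)) (.or (.dia i φ) (.dia i ψ)) ∈ L :=
  hL.subst (fun p => if p = 0 then φ else ψ) _ (hL.dia_or i)

theorem neg_dia_mem (hL : IsLogic L) (i : Fin n) (h : Formula.neg φ ∈ L) :
    Formula.neg (.dia i φ) ∈ L :=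
  hL.of_eval₂ (hL.mono i φ .bot h) (hL.dia_bot i) fun v => by simp; tauto

theorem iff_dia_mem (hL : IsLogic L) (i : Fin n) (h : Formula.iff φ ψ ∈ L) :
    Formula.iff (.dia i φ) (.dia i ψ) ∈ L :=
  hL.of_eval₂ (hL.mono i φ ψ (hL.of_eval₁ h fun v => by simp; tauto))
    (hL.mono i ψ φ (hL.of_eval₁ h fun v => by simp; tauto)) fun v => by simp; tauto

theorem diaAny_mono (hL : IsLogic L) (h : .imp φ ψ ∈ L) :
    .imp (.diaAny φ) (.diaAny ψ) ∈ L := by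
  have hall : ∀ l : List (Fin n),
      .imp (.bigOr (l.map fun i => .dia i φ)) (.bigOr (l.map fun i => .dia i ψ)) ∈ L := by
    intro l
    induction l with
    | nil => exact hL.taut _ fun v => by simp
    | cons i l ih =>
      refine hL.of_eval₂ (hL.mono i φ ψ h) ih fun v => ?_
      change _ → _ → Formula.eval v (.imp (.or (.dia i φ) (.bigOr _))
        (.or (.dia i ψ) (.bigOr _)))
      simp only [Formula.eval_imp, Formula.eval_or]
      tauto
  exact hall _

end IsLogic

namespace ModalLogic

variable {n : ℕ}

theorem subset_extendBy (L Ψ : Set (Formula n)) : L ∪ Ψ ⊆ extendBy L Ψ :=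
  fun _ hφ _ hL' => hL'.2 hφ

theorem isLogic_ofHeight (L : Set (Formula n)) (h : ℕ) : IsLogic (ofHeight L h) :=
  isLogic_extendBy _ _

theorem subset_ofHeight (L : Set (Formula n)) (h : ℕ) : L ⊆ ofHeight L h :=
  fun _ hφ => subset_extendBy _ _ (Or.inl hφ)

theorem heightFormula_mem_ofHeight (L : Set (Formula n)) (h : ℕ) :
    heightFormula L h ∈ ofHeight L h :=
  subset_extendBy _ _ (Or.inr rfl)

theorem isKFormula_diaStar (L : Set (Formula n)) {k : ℕ} {φ : Formula n} (h : φ.IsKFormula k) :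
    (diaStar L φ).IsKFormula k :=
  h.diaLe _

theorem isKFormula_boxStar (L : Set (Formula n)) {k : ℕ} {φ : Formula n} (h : φ.IsKFormula k) :
    (boxStar L φ).IsKFormula k :=
  h.boxLe _

theorem isKFormula_heightFormula (L : Set (Formula n)) (i : ℕ) :
    (heightFormula L i).IsKFormula (i + 1) := by
  induction i with
  | zero => trivial
  | succ i ih =>
    have hv : (Formula.var (i + 1) : Formula n).IsKFormula (i + 1 + 1) := Nat.lt_succ_self _
    exact ⟨hv, Formula.IsKFormula.boxLe _
      (Formula.isKFormula_or.2 ⟨hv.diaLe _, ih.mono (Nat.le_succ _)⟩)⟩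

theorem subst_heightFormula_succ (L : Set (Formula n)) (s : ℕ → Formula n) (i : ℕ) :
    (heightFormula L (i + 1)).subst s = .imp (s (i + 1))
      (boxStar L (.or (diaStar L (s (i + 1))) ((heightFormula L i).subst s))) := by
  simp only [heightFormula, boxStar, diaStar, Formula.subst_imp, Formula.subst_boxLe,
    Formula.subst_or, Formula.subst_diaLe]
  rfl

theorem isMTransitive_transIndex {L : Set (Formula n)} (h : IsPretransitive L) :
    IsMTransitive L (transIndex L) :=
  Nat.sInf_mem (s := {m | IsMTransitive L m}) h

/-! ### Maximal consistent sets -/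

section MaxConsistent

variable {L : Set (Formula n)} {k : ℕ}

theorem exists_isMaxConsistent {Γ : Set (Formula n)} (hΓ : ∀ ψ ∈ Γ, ψ.IsKFormula k)
    (hcons : IsConsistentSet L Γ) : ∃ x, IsMaxConsistent L k x ∧ Γ ⊆ x := by
  obtain ⟨x, hx, hmax⟩ := zorn_subset_nonempty
    {Γ : Set (Formula n) | (∀ ψ ∈ Γ, ψ.IsKFormula k) ∧ IsConsistentSet L Γ}
    (fun c hc hchain hne => by
      refine ⟨⋃₀ c, ⟨?_, ?_⟩, fun s hs => Set.subset_sUnion_of_mem hs⟩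
      · rintro ψ ⟨s, hs, hψ⟩
        exact (hc hs).1 ψ hψ
      · intro l hl
        obtain ⟨s, hs, hsub⟩ := hchain.directedOn.exists_mem_subset_of_finite_of_subset_sUnion
          hne l.finite_toSet hl
        exact (hc hs).2 l hsub)
    Γ ⟨hΓ, hcons⟩
  exact ⟨x, hmax, hx⟩

namespace IsMaxConsistent

variable {x y : Set (Formula n)} {φ ψ : Formula n}

theorem isKFormula (hx : IsMaxConsistent L k x) (h : φ ∈ x) : φ.IsKFormula k := hx.1.1 φ h

theorem mem_of_imp_mem (hL : IsLogic L) (hx : IsMaxConsistent L k x) {l : List (Formula n)}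
    (hl : ∀ ψ ∈ l, ψ ∈ x) (hφ : φ.IsKFormula k) (h : Formula.imp (.bigAnd l) φ ∈ L) : φ ∈ x := by
  classical
  refine hx.2 (y := insert φ x) ⟨?_, ?_⟩ (Set.subset_insert _ _) (Set.mem_insert _ _)
  · rintro ψ (rfl | hψ)
    exacts [hφ, hx.isKFormula hψ]
  · intro l' hl' hbot
    refine hx.1.2 (l ++ l'.filter (· ≠ φ)) ?_ ?_
    · simp only [List.mem_append, List.mem_filter, decide_eq_true_eq]
      rintro ψ (hψ | ⟨hψ, hne⟩)
      exacts [hl ψ hψ, (hl' ψ hψ).resolve_left hne]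
    · refine hL.of_eval₂ h hbot fun v => ?_
      simp only [Formula.eval_imp, Formula.eval_neg, Formula.eval_bigAnd, List.mem_append,
        List.mem_filter, decide_eq_true_eq]
      intro h₁ h₂ h₃
      refine h₂ fun χ hχ => ?_
      by_cases hne : χ = φ
      · exact hne ▸ h₁ fun ψ hψ => h₃ ψ (Or.inl hψ)
      · exact h₃ χ (Or.inr ⟨hχ, hne⟩)

theorem mem_of_mem (hL : IsLogic L) (hx : IsMaxConsistent L k x) (hφ : φ.IsKFormula k)
    (h : φ ∈ L) : φ ∈ x :=
  hx.mem_of_imp_mem hL (l := []) (by simp) hφ (hL.of_eval₁ h fun v => by simp)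

theorem mem_of_imp (hL : IsLogic L) (hx : IsMaxConsistent L k x) (hψ : ψ.IsKFormula k)
    (h : Formula.imp φ ψ ∈ L) (hφ : φ ∈ x) : ψ ∈ x :=
  hx.mem_of_imp_mem hL (l := [φ]) (by simpa) hψ (hL.of_eval₁ h fun v => by simp)

theorem bot_notMem (hL : IsLogic L) (hx : IsMaxConsistent L k x) : Formula.bot ∉ x := fun h =>
  hx.1.2 [.bot] (by simpa) (hL.taut _ fun v => by simp)

theorem neg_mem_iff (hL : IsLogic L) (hx : IsMaxConsistent L k x) (hφ : φ.IsKFormula k) :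
    Formula.neg φ ∈ x ↔ φ ∉ x := by
  classical
  constructor
  · intro h h'
    exact hx.1.2 [φ, .neg φ] (by simp [h, h']) (hL.taut _ fun v => by simp)
  · intro h
    by_contra hneg
    refine h (hx.2 (y := insert φ x) ⟨?_, ?_⟩ (Set.subset_insert _ _) (Set.mem_insert _ _))
    · rintro ψ (rfl | hψ)
      exacts [hφ, hx.isKFormula hψ]
    · intro l hl hbot
      refine hneg (hx.mem_of_imp_mem hL (l := l.filter (· ≠ φ)) ?_ (by simpa) ?_)
      · simp only [List.mem_filter, decide_eq_true_eq]
        rintro ψ ⟨hψ, hne⟩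
        exact (hl ψ hψ).resolve_left hne
      · refine hL.of_eval₁ hbot fun v => ?_
        simp only [Formula.eval_imp, Formula.eval_neg, Formula.eval_bigAnd,
          List.mem_filter, decide_eq_true_eq]
        intro h₁ h₂ h₃
        refine h₁ fun χ hχ => ?_
        by_cases hne : χ = φ
        · exact hne ▸ h₃
        · exact h₂ χ ⟨hχ, hne⟩

theorem imp_mem_iff (hL : IsLogic L) (hx : IsMaxConsistent L k x) (hφ : φ.IsKFormula k)
    (hψ : ψ.IsKFormula k) : Formula.imp φ ψ ∈ x ↔ (φ ∈ x → ψ ∈ x) := by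
  constructor
  · intro h h'
    exact hx.mem_of_imp_mem hL (l := [φ, .imp φ ψ]) (by simp [h, h']) hψ
      (hL.taut _ fun v => by simp; tauto)
  · intro h
    by_cases h' : φ ∈ x
    · exact hx.mem_of_imp hL ⟨hφ, hψ⟩ (hL.taut _ fun v => by simp; tauto) (h h')
    · exact hx.mem_of_imp hL (φ := .neg φ) ⟨hφ, hψ⟩ (hL.taut _ fun v => by simp; tauto)
        ((hx.neg_mem_iff hL hφ).2 h')

theorem or_mem_iff (hL : IsLogic L) (hx : IsMaxConsistent L k x) (hφ : φ.IsKFormula k)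
    (hψ : ψ.IsKFormula k) : Formula.or φ ψ ∈ x ↔ φ ∈ x ∨ ψ ∈ x := by
  rw [Formula.or, hx.imp_mem_iff hL (by simpa) hψ, hx.neg_mem_iff hL hφ]
  tauto

theorem and_mem_iff (hL : IsLogic L) (hx : IsMaxConsistent L k x) (hφ : φ.IsKFormula k)
    (hψ : ψ.IsKFormula k) : Formula.and φ ψ ∈ x ↔ φ ∈ x ∧ ψ ∈ x := by
  rw [Formula.and, hx.neg_mem_iff hL (by simp [hφ, hψ]), hx.imp_mem_iff hL hφ (by simpa),
    hx.neg_mem_iff hL hψ]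
  tauto

theorem iff_mem_iff (hL : IsLogic L) (hx : IsMaxConsistent L k x) (hφ : φ.IsKFormula k)
    (hψ : ψ.IsKFormula k) : Formula.iff φ ψ ∈ x ↔ (φ ∈ x ↔ ψ ∈ x) := by
  rw [Formula.iff, hx.and_mem_iff hL (by simp [hφ, hψ]) (by simp [hφ, hψ]), hx.imp_mem_iff hL hφ hψ,
    hx.imp_mem_iff hL hψ hφ]
  tauto

theorem bigOr_mem_iff (hL : IsLogic L) (hx : IsMaxConsistent L k x) {l : List (Formula n)}
    (hl : ∀ χ ∈ l, χ.IsKFormula k) : .bigOr l ∈ x ↔ ∃ χ ∈ l, χ ∈ x := by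
  induction l with
  | nil => simpa [Formula.bigOr] using hx.bot_notMem hL
  | cons χ l ih =>
    simp only [List.mem_cons, forall_eq_or_imp] at hl
    change Formula.or χ (.bigOr l) ∈ x ↔ _
    rw [hx.or_mem_iff hL hl.1 (by simpa using hl.2), ih hl.2]
    simp

theorem bigAnd_mem_iff (hL : IsLogic L) (hx : IsMaxConsistent L k x) {l : List (Formula n)}
    (hl : ∀ χ ∈ l, χ.IsKFormula k) : .bigAnd l ∈ x ↔ ∀ χ ∈ l, χ ∈ x := by
  induction l with
  | nil =>
    simpa [Formula.bigAnd] using (hx.neg_mem_iff hL (by simp)).2 (hx.bot_notMem hL)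
  | cons χ l ih =>
    simp only [List.mem_cons, forall_eq_or_imp] at hl
    change Formula.and χ (.bigAnd l) ∈ x ↔ _
    rw [hx.and_mem_iff hL hl.1 (by simpa using hl.2), ih hl.2]
    simp

theorem eq_of_subset (hx : IsMaxConsistent L k x) (hy : IsMaxConsistent L k y) (h : y ⊆ x) :
    x = y :=
  Set.Subset.antisymm (hy.2 hx.1 h) h

end IsMaxConsistent

/-- A prime upper set `P` of `k`-formulas that contains a directed set `Δ` includes a maximal
consistent set containing `Δ`. -/
theorem exists_isMaxConsistent_between (hL : IsLogic L) {P : Formula n → Prop}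
    {Δ : Set (Formula n)} (hup : ∀ φ ψ : Formula n, ψ.IsKFormula k → .imp φ ψ ∈ L → P φ → P ψ)
    (hor : ∀ φ ψ : Formula n, φ.IsKFormula k → ψ.IsKFormula k → P (.or φ ψ) → P φ ∨ P ψ)
    (hbot : ¬ P .bot) (hne : Δ.Nonempty) (hΔk : ∀ φ ∈ Δ, φ.IsKFormula k)
    (hdir : ∀ φ ∈ Δ, ∀ ψ ∈ Δ, ∃ χ ∈ Δ, Formula.imp χ φ ∈ L ∧ Formula.imp χ ψ ∈ L)
    (hΔ : ∀ φ ∈ Δ, P φ) :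
    ∃ x, IsMaxConsistent L k x ∧ Δ ⊆ x ∧ ∀ φ ∈ x, P φ := by
  let Γ : Set (Formula n) := Δ ∪ {χ | ∃ ψ : Formula n, ψ.IsKFormula k ∧ ¬ P ψ ∧ χ = .neg ψ}
  have hΓk : ∀ χ ∈ Γ, χ.IsKFormula k := by
    rintro χ (h | ⟨ψ, hψ, _, rfl⟩)
    exacts [hΔk χ h, by simpa]
  have key : ∀ l : List (Formula n), (∀ χ ∈ l, χ ∈ Γ) →
      ∃ δ ∈ Δ, ∀ δ' ∈ Δ, Formula.imp δ' δ ∈ L → P (.and δ' (.bigAnd l)) := by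
    intro l
    induction l with
    | nil =>
      intro _
      obtain ⟨δ, hδ⟩ := hne
      refine ⟨δ, hδ, fun δ' hδ' _ => hup δ' _ ?_ (hL.taut _ fun v => by simp) (hΔ _ hδ')⟩
      simp [hΔk _ hδ']
    | cons χ l ih =>
      intro hl
      simp only [List.mem_cons, forall_eq_or_imp] at hl
      obtain ⟨δ, hδ, hP⟩ := ih hl.2
      have hlk : ∀ χ ∈ l, χ.IsKFormula k := fun χ hχ => hΓk χ (hl.2 χ hχ)
      rcases hl.1 with hχ | ⟨ψ, hψ, hnP, rfl⟩
      · obtain ⟨δ₁, hδ₁, h₁, h₂⟩ := hdir _ hδ _ hχ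
        refine ⟨δ₁, hδ₁, fun δ' hδ' himp => hup _ _ ?_ ?_ (hP δ' hδ' ?_)⟩
        · simpa [hΔk _ hδ', hΔk _ hχ] using hlk
        · exact hL.of_eval₂ himp h₂ fun v => by simp; tauto
        · exact hL.of_eval₂ himp h₁ fun v => by simp; tauto
      · refine ⟨δ, hδ, fun δ' hδ' himp => ?_⟩
        have hk : (Formula.and δ' (.bigAnd (.neg ψ :: l))).IsKFormula k := by
          simpa [hΔk _ hδ', hψ] using hlk
        have := hup (.and δ' (.bigAnd l)) (.or (.and δ' (.bigAnd (.neg ψ :: l))) ψ)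
          (by simpa [hψ] using hk) (hL.taut _ fun v => by simp; tauto) (hP δ' hδ' himp)
        exact (hor _ _ hk hψ this).resolve_right hnP
  obtain ⟨x, hx, hsub⟩ := exists_isMaxConsistent hΓk (L := L) (by
    intro l hl hbad
    obtain ⟨δ, hδ, hP⟩ := key l hl
    refine hbot (hup _ _ (by simp) ?_ (hP δ hδ (hL.taut _ fun v => by simp)))
    exact hL.of_eval₁ hbad fun v => by simp; tauto)
  refine ⟨x, hx, fun φ hφ => hsub (Or.inl hφ), fun φ hφ => ?_⟩
  by_contra hnP
  have hk := hx.isKFormula hφ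
  exact (hx.neg_mem_iff hL hk).1 (hsub (Or.inr ⟨φ, hk, hnP, rfl⟩)) hφ

end MaxConsistent

end ModalLogic

/-! ### The canonical frame -/

namespace ModalLogic

variable {n : ℕ} {L : Set (Formula n)} {k : ℕ} {φ : Formula n}

section Truth

theorem exists_canonical_extension (hL : IsLogic L) {P : Formula n → Prop} {φ : Formula n}
    (hup : ∀ φ ψ : Formula n, ψ.IsKFormula k → .imp φ ψ ∈ L → P φ → P ψ)
    (hor : ∀ φ ψ : Formula n, φ.IsKFormula k → ψ.IsKFormula k → P (.or φ ψ) → P φ ∨ P ψ)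
    (hbot : ¬ P .bot) (hφ : φ.IsKFormula k) (hP : P φ) :
    ∃ y : (canonicalFrame L k).W, φ ∈ y.1 ∧ ∀ ψ ∈ y.1, P ψ := by
  obtain ⟨y, hy, hsub, h⟩ := exists_isMaxConsistent_between hL (Δ := {φ}) hup hor hbot
    (Set.singleton_nonempty φ) (by simpa) (fun χ hχ ψ hψ => by
      obtain rfl : χ = φ := hχ
      obtain rfl : ψ = χ := hψ
      exact ⟨ψ, rfl, hL.taut _ fun v => by simp, hL.taut _ fun v => by simp⟩) (by simpa)
  exact ⟨⟨y, hy⟩, hsub rfl, h⟩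

theorem dia_mem_iff (hL : IsLogic L) (hφ : φ.IsKFormula k) (i : Fin n)
    (x : (canonicalFrame L k).W) :
    Formula.dia i φ ∈ x.1 ↔ ∃ y, (canonicalFrame L k).R i x y ∧ φ ∈ y.1 := by
  constructor
  · intro h
    obtain ⟨y, hy, hR⟩ := exists_canonical_extension hL (P := fun ψ => .dia i ψ ∈ x.1)
      (fun φ ψ hψ himp h => x.2.mem_of_imp hL (by simpa) (hL.mono i φ ψ himp) h)
      (fun φ ψ hφ hψ h => (x.2.or_mem_iff hL (by simpa) (by simpa)).1
        (x.2.mem_of_imp hL (by simp [hφ, hψ]) (hL.dia_or_mem i φ ψ) h))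
      (fun h => (x.2.neg_mem_iff hL (by simp)).1 (x.2.mem_of_mem hL (by simp) (hL.dia_bot i)) h)
      hφ h
    exact ⟨y, hR, hy⟩
  · rintro ⟨y, hR, hy⟩
    exact hR φ hy

theorem diaAny_mem_iff (hL : IsLogic L) (hφ : φ.IsKFormula k) (x : (canonicalFrame L k).W) :
    Formula.diaAny φ ∈ x.1 ↔ ∃ y, (canonicalFrame L k).rel x y ∧ φ ∈ y.1 := by
  rw [Formula.diaAny, x.2.bigOr_mem_iff hL (by simp [hφ])]
  simp only [List.mem_map, List.mem_finRange, true_and, exists_exists_eq_and,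
    dia_mem_iff hL hφ, KripkeFrame.rel]
  constructor
  · rintro ⟨i, y, h, hy⟩
    exact ⟨y, ⟨i, h⟩, hy⟩
  · rintro ⟨y, ⟨i, h⟩, hy⟩
    exact ⟨i, y, h, hy⟩

theorem diaPow_mem_iff (hL : IsLogic L) (hφ : φ.IsKFormula k) (m : ℕ)
    (x : (canonicalFrame L k).W) :
    Formula.diaPow m φ ∈ x.1 ↔ ∃ y, (canonicalFrame L k).relPow m x y ∧ φ ∈ y.1 := by
  induction m generalizing φ with
  | zero => simp [Formula.diaPow, KripkeFrame.relPow]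
  | succ m ih =>
    rw [Formula.diaPow, ih hφ.diaAny]
    simp only [diaAny_mem_iff hL hφ, KripkeFrame.relPow]
    constructor
    · rintro ⟨z, hxz, y, hzy, hy⟩
      exact ⟨y, ⟨z, hxz, hzy⟩, hy⟩
    · rintro ⟨y, ⟨z, hxz, hzy⟩, hy⟩
      exact ⟨z, hxz, y, hzy, hy⟩

theorem diaLe_mem_iff_exists_diaPow (hL : IsLogic L) (hφ : φ.IsKFormula k) (m : ℕ)
    (x : (canonicalFrame L k).W) :
    Formula.diaLe m φ ∈ x.1 ↔ ∃ l ≤ m, Formula.diaPow l φ ∈ x.1 := by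
  rw [Formula.diaLe, x.2.bigOr_mem_iff hL]
  · simp
  · simp only [List.mem_map]
    rintro _ ⟨l, _, rfl⟩
    exact hφ.diaPow l

theorem diaLe_mem_of_rel (hL : IsLogic L) {m : ℕ} (hm : IsMTransitive L m)
    (hφ : φ.IsKFormula k) {x y : (canonicalFrame L k).W} (hxy : (canonicalFrame L k).rel x y)
    (h : Formula.diaLe m φ ∈ y.1) : Formula.diaLe m φ ∈ x.1 := by
  obtain ⟨l, hl, h⟩ := (diaLe_mem_iff_exists_diaPow hL hφ m y).1 h
  obtain ⟨z, hz, hφz⟩ := (diaPow_mem_iff hL hφ l y).1 h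
  have hx : Formula.diaPow (l + 1) φ ∈ x.1 := (diaPow_mem_iff hL hφ _ x).2 ⟨z, hz.head hxy, hφz⟩
  rcases hl.lt_or_eq with hlt | rfl
  · exact (diaLe_mem_iff_exists_diaPow hL hφ m x).2 ⟨l + 1, hlt, hx⟩
  · have := hL.subst (fun _ => φ) _ hm
    rw [Formula.subst_imp, Formula.subst_diaPow, Formula.subst_diaLe] at this
    exact x.2.mem_of_imp hL (hφ.diaLe l) this hx

theorem diaStar_mem_iff (hL : IsLogic L) (hpre : IsPretransitive L) (hφ : φ.IsKFormula k)
    (x : (canonicalFrame L k).W) :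
    diaStar L φ ∈ x.1 ↔ ∃ y, (canonicalFrame L k).relStar x y ∧ φ ∈ y.1 := by
  constructor
  · intro h
    obtain ⟨l, _, h⟩ := (diaLe_mem_iff_exists_diaPow hL hφ _ x).1 h
    obtain ⟨y, hy, hφy⟩ := (diaPow_mem_iff hL hφ l x).1 h
    exact ⟨y, hy.relStar, hφy⟩
  · rintro ⟨y, hxy, hy⟩
    induction hxy using Relation.ReflTransGen.head_induction_on with
    | refl => exact (diaLe_mem_iff_exists_diaPow hL hφ _ y).2 ⟨0, Nat.zero_le _, hy⟩
    | head hac _ ih => exact diaLe_mem_of_rel hL (isMTransitive_transIndex hpre) hφ hac ih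

theorem boxStar_mem_iff (hL : IsLogic L) (hpre : IsPretransitive L) (hφ : φ.IsKFormula k)
    (x : (canonicalFrame L k).W) :
    boxStar L φ ∈ x.1 ↔ ∀ y, (canonicalFrame L k).relStar x y → φ ∈ y.1 := by
  have hneg : φ.neg.IsKFormula k := Formula.isKFormula_neg.2 hφ
  have hk : (diaStar L φ.neg).IsKFormula k := isKFormula_diaStar L hneg
  have hbox : boxStar L φ = .neg (diaStar L (.neg φ)) := rfl
  rw [hbox, x.2.neg_mem_iff hL hk, diaStar_mem_iff hL hpre hneg]
  simp only [not_exists, not_and]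
  refine forall₂_congr fun y _ => ?_
  rw [y.2.neg_mem_iff hL hφ, not_not]

end Truth

section Tightness

theorem rel_of_diaAny_mem (hL : IsLogic L) {x y : (canonicalFrame L k).W}
    (h : ∀ φ ∈ y.1, Formula.diaAny φ ∈ x.1) : (canonicalFrame L k).rel x y := by
  by_contra hrel
  have : ∀ i : Fin n, ∃ φ ∈ y.1, Formula.dia i φ ∉ x.1 := by
    intro i
    by_contra! hi
    exact hrel ⟨i, hi⟩
  choose f hf hfx using this
  have hk : ∀ χ ∈ (List.finRange n).map f, χ.IsKFormula k := by
    simpa using fun i => y.2.isKFormula (hf i)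
  have hmem : .bigAnd ((List.finRange n).map f) ∈ y.1 :=
    (y.2.bigAnd_mem_iff hL hk).2 (by simpa using hf)
  obtain ⟨z, ⟨i, hi⟩, hz⟩ := (diaAny_mem_iff hL (by simpa using hk) x).1 (h _ hmem)
  exact hfx i (hi _ ((z.2.bigAnd_mem_iff hL hk).1 hz _ (by simp)))

theorem relPow_of_diaPow_mem (hL : IsLogic L) {m : ℕ} {x y : (canonicalFrame L k).W}
    (h : ∀ φ ∈ y.1, Formula.diaPow m φ ∈ x.1) : (canonicalFrame L k).relPow m x y := by
  induction m generalizing y with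
  | zero => exact Subtype.ext (x.2.eq_of_subset y.2 h)
  | succ m ih =>
    have htop : Formula.neg .bot ∈ y.1 := y.2.mem_of_mem hL (by simp) (hL.taut _ fun v => by simp)
    obtain ⟨z, hz, hsub, hzP⟩ := exists_isMaxConsistent_between (k := k) hL
      (P := fun ψ => ψ.IsKFormula k ∧ Formula.diaPow m ψ ∈ x.1) (Δ := Formula.diaAny '' y.1)
      (fun φ ψ hψ himp ⟨hφ, hP⟩ => by
        obtain ⟨w, hw, hφw⟩ := (diaPow_mem_iff hL hφ m x).1 hP
        exact ⟨hψ, (diaPow_mem_iff hL hψ m x).2 ⟨w, hw, w.2.mem_of_imp hL hψ himp hφw⟩⟩)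
      (fun φ ψ hφ hψ ⟨hk, hP⟩ => by
        obtain ⟨w, hw, hor⟩ := (diaPow_mem_iff hL hk m x).1 hP
        exact ((w.2.or_mem_iff hL hφ hψ).1 hor).imp
          (fun h => ⟨hφ, (diaPow_mem_iff hL hφ m x).2 ⟨w, hw, h⟩⟩)
          (fun h => ⟨hψ, (diaPow_mem_iff hL hψ m x).2 ⟨w, hw, h⟩⟩))
      (fun ⟨hk, hP⟩ => by
        obtain ⟨w, _, hbot⟩ := (diaPow_mem_iff hL hk m x).1 hP
        exact w.2.bot_notMem hL hbot)
      ⟨_, _, htop, rfl⟩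
      (by
        rintro _ ⟨φ, hφ, rfl⟩
        exact (y.2.isKFormula hφ).diaAny)
      (by
        rintro _ ⟨φ, hφ, rfl⟩ _ ⟨ψ, hψ, rfl⟩
        have hφk := y.2.isKFormula hφ
        have hψk := y.2.isKFormula hψ
        refine ⟨_, ⟨.and φ ψ, (y.2.and_mem_iff hL hφk hψk).2 ⟨hφ, hψ⟩, rfl⟩, ?_, ?_⟩
        · exact hL.diaAny_mono (hL.taut _ fun v => by simp; tauto)
        · exact hL.diaAny_mono (hL.taut _ fun v => by simp))
      (by
        rintro _ ⟨φ, hφ, rfl⟩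
        exact ⟨(y.2.isKFormula hφ).diaAny, h φ hφ⟩)
    exact ⟨⟨z, hz⟩, ih fun ψ hψ => (hzP ψ hψ).2,
      rel_of_diaAny_mem hL fun φ hφ => hsub ⟨φ, hφ, rfl⟩⟩

theorem relStar_iff (hL : IsLogic L) (hpre : IsPretransitive L) {x y : (canonicalFrame L k).W} :
    (canonicalFrame L k).relStar x y ↔ ∀ φ ∈ y.1, diaStar L φ ∈ x.1 := by
  constructor
  · intro h φ hφ
    exact (diaStar_mem_iff hL hpre (y.2.isKFormula hφ) x).2 ⟨y, h, hφ⟩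
  · intro h
    by_contra hrel
    have : ∀ l, ∃ φ ∈ y.1, Formula.diaPow l φ ∉ x.1 := by
      intro l
      by_contra! hl
      exact hrel (relPow_of_diaPow_mem hL hl).relStar
    choose f hf hfx using this
    let l₀ := (List.range (transIndex L + 1)).map f
    have hk : ∀ χ ∈ l₀, χ.IsKFormula k := by
      intro χ hχ
      obtain ⟨i, _, rfl⟩ := List.mem_map.1 hχ
      exact y.2.isKFormula (hf i)
    have hmem : .bigAnd l₀ ∈ y.1 := (y.2.bigAnd_mem_iff hL hk).2 fun χ hχ => by
      obtain ⟨i, _, rfl⟩ := List.mem_map.1 hχ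
      exact hf i
    have hkand : (Formula.bigAnd l₀).IsKFormula k := by simpa using hk
    obtain ⟨l, hl, hpow⟩ := (diaLe_mem_iff_exists_diaPow hL hkand _ x).1 (h _ hmem)
    obtain ⟨z, hxz, hz⟩ := (diaPow_mem_iff hL hkand l x).1 hpow
    refine hfx l ((diaPow_mem_iff hL (y.2.isKFormula (hf l)) l x).2 ⟨z, hxz, ?_⟩)
    exact (z.2.bigAnd_mem_iff hL hk).1 hz _
      (List.mem_map.2 ⟨l, List.mem_range.2 (Nat.lt_succ_of_le hl), rfl⟩)

end Tightness

/-- Above every point of the canonical frame at which `φ` holds there is a maximal one. -/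
theorem exists_maximal_mem (hL : IsLogic L) (hpre : IsPretransitive L)
    {x : (canonicalFrame L k).W} (hx : φ ∈ x.1) :
    ∃ y, (canonicalFrame L k).relStar x y ∧ φ ∈ y.1 ∧
      ∀ z, (canonicalFrame L k).relStar y z → φ ∈ z.1 → (canonicalFrame L k).relStar z y := by
  have hφ := x.2.isKFormula hx
  let S := {y : (canonicalFrame L k).W // (canonicalFrame L k).relStar x y ∧ φ ∈ y.1}
  have : Nonempty S := ⟨⟨x, Relation.ReflTransGen.refl, hx⟩⟩
  obtain ⟨m, hm⟩ := exists_maximal_of_nonempty_chains_bounded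
    (r := fun a b : S => (canonicalFrame L k).relStar a.1 b.1)
    (fun c hc ⟨c₀, hc₀⟩ => by
      have htrans : ∀ {a b : (canonicalFrame L k).W} {ψ : Formula n}, ψ.IsKFormula k →
          (canonicalFrame L k).relStar a b → diaStar L ψ ∈ b.1 → diaStar L ψ ∈ a.1 := by
        intro a b ψ hψ hab hb
        obtain ⟨w, hw, hψw⟩ := (diaStar_mem_iff hL hpre hψ b).1 hb
        exact (diaStar_mem_iff hL hpre hψ a).2 ⟨w, hab.trans hw, hψw⟩
      obtain ⟨u, hu, huP⟩ := exists_canonical_extension hL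
        (P := fun ψ => ψ.IsKFormula k ∧ ∀ a ∈ c, diaStar L ψ ∈ a.1.1)
        (fun χ ψ hψ himp ⟨hχ, h⟩ => ⟨hψ, fun a ha => by
          obtain ⟨w, hw, hχw⟩ := (diaStar_mem_iff hL hpre hχ a.1).1 (h a ha)
          exact (diaStar_mem_iff hL hpre hψ a.1).2 ⟨w, hw, w.2.mem_of_imp hL hψ himp hχw⟩⟩)
        (fun χ ψ hχ hψ ⟨hk, h⟩ => by
          by_contra! hcon
          obtain ⟨a, ha, hχa⟩ := hcon.1 hχ
          obtain ⟨b, hb, hψb⟩ := hcon.2 hψ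
          have : ∃ d ∈ c, (canonicalFrame L k).relStar a.1 d.1 ∧
              (canonicalFrame L k).relStar b.1 d.1 := by
            by_cases hab : a = b
            · exact ⟨a, ha, Relation.ReflTransGen.refl, hab ▸ Relation.ReflTransGen.refl⟩
            · rcases hc ha hb hab with h' | h'
              · exact ⟨b, hb, h', Relation.ReflTransGen.refl⟩
              · exact ⟨a, ha, Relation.ReflTransGen.refl, h'⟩
          obtain ⟨d, hd, had, hbd⟩ := this
          obtain ⟨w, hw, hor⟩ := (diaStar_mem_iff hL hpre hk d.1).1 (h d hd)
          rcases (w.2.or_mem_iff hL hχ hψ).1 hor with h' | h'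
          · exact hχa (htrans hχ had ((diaStar_mem_iff hL hpre hχ d.1).2 ⟨w, hw, h'⟩))
          · exact hψb (htrans hψ hbd ((diaStar_mem_iff hL hpre hψ d.1).2 ⟨w, hw, h'⟩)))
        (fun ⟨hk, h⟩ => by
          obtain ⟨w, _, hbot⟩ := (diaStar_mem_iff hL hpre hk c₀.1).1 (h c₀ hc₀)
          exact w.2.bot_notMem hL hbot)
        hφ ⟨hφ, fun a _ => (diaStar_mem_iff hL hpre hφ a.1).2
          ⟨a.1, Relation.ReflTransGen.refl, a.2.2⟩⟩
      have hcu : ∀ a ∈ c, (canonicalFrame L k).relStar a.1 u := fun a ha =>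
        (relStar_iff hL hpre).2 fun ψ hψ => (huP ψ hψ).2 a ha
      exact ⟨⟨u, c₀.2.1.trans (hcu c₀ hc₀), hu⟩, hcu⟩)
    (fun {a b c} hab hbc => hab.trans hbc)
  exact ⟨m.1, m.2.1, m.2.2, fun z hz hφz => hm ⟨z, m.2.1.trans hz, hφz⟩ hz⟩

end ModalLogic

/-! ### Finite height and the canonical frame -/

namespace ModalLogic

variable {n : ℕ} {L : Set (Formula n)} {k : ℕ} {φ : Formula n}

/-- The formulas all of whose `k`-instances hold throughout the cone of `x` form a logic. -/
theorem isLogic_cone (hL : IsLogic L) (x : (canonicalFrame L k).W) :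
    IsLogic {φ : Formula n | ∀ s : ℕ → Formula n, (∀ p, (s p).IsKFormula k) →
      ∀ y, (canonicalFrame L k).relStar x y → φ.subst s ∈ y.1} := by
  have hsub : ∀ φ ∈ L, ∀ s : ℕ → Formula n, (∀ p, (s p).IsKFormula k) →
      ∀ y, (canonicalFrame L k).relStar x y → φ.subst s ∈ y.1 := fun φ hφ s hs y _ =>
    y.2.mem_of_mem hL (Formula.IsKFormula.subst s hs φ) (hL.subst s φ hφ)
  refine ⟨fun φ hφ => hsub φ (hL.taut φ hφ), fun i => hsub _ (hL.dia_or i),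
    fun i => hsub _ (hL.dia_bot i), ?_, ?_, ?_⟩
  · intro φ ψ h₁ h₂ s hs y hy
    exact (y.2.imp_mem_iff hL (Formula.IsKFormula.subst s hs φ)
      (Formula.IsKFormula.subst s hs ψ)).1 (h₁ s hs y hy) (h₂ s hs y hy)
  · intro t φ h s hs y hy
    rw [Formula.subst_subst]
    exact h _ (fun p => Formula.IsKFormula.subst s hs (t p)) y hy
  · intro i φ ψ h s hs y hy
    have hφ := Formula.IsKFormula.subst s hs φ
    have hψ := Formula.IsKFormula.subst s hs ψ
    refine (y.2.imp_mem_iff hL (Formula.isKFormula_dia.2 hφ) (Formula.isKFormula_dia.2 hψ)).2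
      fun hdia => ?_
    obtain ⟨z, hz, hφz⟩ := (dia_mem_iff hL hφ i y).1 hdia
    have hxz : (canonicalFrame L k).relStar x z := hy.tail ⟨i, hz⟩
    exact (dia_mem_iff hL hψ i y).2 ⟨z, hz, (z.2.imp_mem_iff hL hφ hψ).1 (h s hs z hxz) hφz⟩

theorem subst_heightFormula_mem (hL : IsLogic L) (hpre : IsPretransitive L)
    {s : ℕ → Formula n} (hs : ∀ p, (s p).IsKFormula k) {i : ℕ} {x : (canonicalFrame L k).W}
    (hx : (canonicalFrame L k).depth x ≤ (i : ℕ∞)) : (heightFormula L i).subst s ∈ x.1 := by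
  induction i generalizing x with
  | zero => exact absurd hx (KripkeFrame.not_depth_le_zero _ x)
  | succ i ih =>
    have hB := Formula.IsKFormula.subst s hs (heightFormula L i)
    have hdia : (diaStar L (s (i + 1))).IsKFormula k := isKFormula_diaStar L (hs (i + 1))
    have hor := Formula.isKFormula_or.2 ⟨hdia, hB⟩
    rw [subst_heightFormula_succ, x.2.imp_mem_iff hL (hs _) (isKFormula_boxStar L hor)]
    intro hvar
    refine (boxStar_mem_iff hL hpre hor x).2 fun y hxy => (y.2.or_mem_iff hL hdia hB).2 ?_
    by_cases hyx : (canonicalFrame L k).relStar y x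
    · exact Or.inl ((diaStar_mem_iff hL hpre (hs _) y).2 ⟨x, hyx, hvar⟩)
    · exact Or.inr (ih ((KripkeFrame.depth_le_succ_iff _ x i).1 hx y hxy hyx))

theorem mem_of_mem_ofHeight (hL : IsLogic L) (hpre : IsPretransitive L) {i : ℕ}
    {x : (canonicalFrame L k).W} (hx : (canonicalFrame L k).depth x ≤ (i : ℕ∞))
    (hφ : φ.IsKFormula k) (h : φ ∈ ofHeight L i) : φ ∈ x.1 := by
  have hcone := h _ ⟨isLogic_cone hL x, Set.union_subset
    (fun ψ hψ s hs y _ => y.2.mem_of_mem hL (Formula.IsKFormula.subst s hs ψ) (hL.subst s ψ hψ))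
    (Set.singleton_subset_iff.2 fun s hs y hxy =>
      subst_heightFormula_mem hL hpre hs (KripkeFrame.depth_mono hxy hx))⟩
  let s : ℕ → Formula n := fun p => if p < k then .var p else .bot
  have hs : ∀ p, (s p).IsKFormula k := fun p => by
    by_cases hp : p < k
    · simp only [s, if_pos hp]
      exact hp
    · simp [s, hp]
  have := hcone s hs x Relation.ReflTransGen.refl
  rwa [Formula.subst_eq_self s hφ fun p hp => by simp [s, hp]] at this

theorem depth_le_of_subst_mem (hL : IsLogic L) (hpre : IsPretransitive L) {i : ℕ}
    {x : (canonicalFrame L k).W}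
    (hx : ∀ s : ℕ → Formula n, (∀ p, (s p).IsKFormula k) →
      ∀ y, (canonicalFrame L k).relStar x y → (heightFormula L i).subst s ∈ y.1) :
    (canonicalFrame L k).depth x ≤ (i : ℕ∞) := by
  induction i generalizing x with
  | zero =>
    exact absurd (hx (fun _ => .bot) (by simp) x Relation.ReflTransGen.refl) (x.2.bot_notMem hL)
  | succ i ih =>
    refine (KripkeFrame.depth_le_succ_iff _ x i).2 fun z hxz hzx => ih fun s hs y hzy => ?_
    rw [relStar_iff hL hpre] at hzx
    push Not at hzx
    obtain ⟨ψ, hψx, hψz⟩ := hzx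
    have hψ := x.2.isKFormula hψx
    let t := Function.update s (i + 1) ψ
    have ht : ∀ p, (t p).IsKFormula k := by
      intro p
      by_cases hp : p = i + 1
      · simpa [t, hp] using hψ
      · simpa [t, hp] using hs p
    have heq : (heightFormula L i).subst s = (heightFormula L i).subst t :=
      (isKFormula_heightFormula L i).subst_congr fun p hp => by simp [t, hp.ne]
    have htψ : t (i + 1) = ψ := by simp [t]
    have hB := Formula.IsKFormula.subst t ht (heightFormula L i)
    have hdia : (diaStar L ψ).IsKFormula k := isKFormula_diaStar L hψ
    have hor := Formula.isKFormula_or.2 ⟨hdia, hB⟩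
    have hmem := hx t ht x Relation.ReflTransGen.refl
    rw [subst_heightFormula_succ, htψ, x.2.imp_mem_iff hL hψ (isKFormula_boxStar L hor)] at hmem
    have hy := (y.2.or_mem_iff hL hdia hB).1
      ((boxStar_mem_iff hL hpre hor x).1 (hmem hψx) y (hxz.trans hzy))
    rw [heq]
    refine hy.resolve_left fun hdy => hψz ?_
    obtain ⟨w, hyw, hψw⟩ := (diaStar_mem_iff hL hpre hψ y).1 hdy
    exact (diaStar_mem_iff hL hpre hψ z).2 ⟨w, hzy.trans hyw, hψw⟩

theorem mem_of_relStar (hL : IsLogic L) {L' : Set (Formula n)} (hL' : IsLogic L')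
    {x y : (canonicalFrame L k).W} (hxy : (canonicalFrame L k).relStar x y)
    (hx : ∀ φ ∈ L', φ.IsKFormula k → φ ∈ x.1) : ∀ φ ∈ L', φ.IsKFormula k → φ ∈ y.1 := by
  induction hxy with
  | refl => exact hx
  | @tail b c _ hbc ih =>
    intro φ hφL hφ
    by_contra hφc
    obtain ⟨i, hi⟩ := hbc
    have hdia := hi _ ((c.2.neg_mem_iff hL hφ).2 hφc)
    refine (b.2.neg_mem_iff hL (by simpa)).1 (ih _ (hL'.neg_dia_mem i (φ := .neg φ) ?_)
      (by simpa)) hdia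
    exact hL'.of_eval₁ hφL fun v => by simp

theorem depth_le_iff_ofHeight (hL : IsLogic L) (hpre : IsPretransitive L) (i : ℕ)
    (x : (canonicalFrame L k).W) :
    (canonicalFrame L k).depth x ≤ (i : ℕ∞) ↔
      ∀ φ ∈ ofHeight L i, φ.IsKFormula k → φ ∈ x.1 := by
  refine ⟨fun hx φ h hφ => mem_of_mem_ofHeight hL hpre hx hφ h, fun hx => ?_⟩
  refine depth_le_of_subst_mem hL hpre fun s hs y hxy => ?_
  exact mem_of_relStar hL (isLogic_ofHeight L i) hxy hx _
    ((isLogic_ofHeight L i).subst s _ (heightFormula_mem_ofHeight L i))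
    (Formula.IsKFormula.subst s hs _)

theorem exists_notMem_of_notMem (hL : IsLogic L) {L' : Set (Formula n)} (hL' : IsLogic L')
    (hsub : L ⊆ L') (hφ : φ.IsKFormula k) (h : φ ∉ L') :
    ∃ x : (canonicalFrame L k).W, φ ∉ x.1 ∧ ∀ ψ ∈ L', ψ.IsKFormula k → ψ ∈ x.1 := by
  obtain ⟨x, hx, hΓ⟩ := exists_isMaxConsistent (L := L) (k := k)
    (Γ := insert (.neg φ) {ψ | ψ ∈ L' ∧ ψ.IsKFormula k})
    (by
      rintro ψ (rfl | hψ)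
      exacts [by simpa, hψ.2])
    (by
      intro l hl hbad
      refine h (hL'.of_eval₂ (hsub hbad)
        (hL'.bigAnd_mem (l := l.map fun χ => .imp (.neg φ) χ) ?_) fun v => ?_)
      · simp only [List.mem_map]
        rintro _ ⟨χ, hχ, rfl⟩
        rcases hl χ hχ with rfl | hχL
        · exact hL'.taut _ fun v => by simp
        · exact hL'.of_eval₁ hχL.1 fun v => by simp; tauto
      · simp only [Formula.eval_neg, Formula.eval_bigAnd, List.mem_map, forall_exists_index,
          and_imp, forall_apply_eq_imp_iff₂, Formula.eval_imp]
        intro h₁ h₂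
        by_contra hv
        exact h₁ fun χ hχ => h₂ χ hχ hv)
  exact ⟨⟨x, hx⟩, (hx.neg_mem_iff hL hφ).1 (hΓ (Or.inl rfl)),
    fun ψ hψ hk => hΓ (Or.inr ⟨hψ, hk⟩)⟩

/-! ### Definability of depth -/

/-- The theory of a `k`-tabular extension of `L` is globally axiomatized over `L` by a single
`k`-formula in the `k`-canonical frame. -/
theorem exists_axiom_of_isKTabular (hL : IsLogic L) {L' : Set (Formula n)} (hL' : IsLogic L')
    (htab : IsKTabular L' k) :
    ∃ γ ∈ L', γ.IsKFormula k ∧ ∀ x : (canonicalFrame L k).W,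
      (∀ y, (canonicalFrame L k).relStar x y → γ ∈ y.1) →
        ∀ φ ∈ L', φ.IsKFormula k → φ ∈ x.1 := by
  obtain ⟨S, hfin, hSk, hS⟩ := htab
  choose! rep hrepS hrep using hS
  let e : Formula n → Formula n := fun φ => .iff φ (rep φ)
  let Θ : Set (Formula n) := (fun p : Formula n × Formula n => e (.imp p.1 p.2)) '' (S ×ˢ S) ∪
    (fun p : Fin n × Formula n => e (.dia p.1 p.2)) '' (Set.univ ×ˢ S) ∪
    (fun p => e (.var p)) '' Set.Iio k ∪ {e .bot} ∪ {s ∈ S | s ∈ L'}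
  have hΘfin : Θ.Finite := by
    refine ((((Set.Finite.image _ (hfin.prod hfin)).union
      (Set.Finite.image _ (Set.finite_univ.prod hfin))).union
      (Set.Finite.image _ (Set.finite_Iio k))).union (Set.finite_singleton _)).union
      (hfin.subset (Set.sep_subset _ _))
  have hek : ∀ φ : Formula n, φ.IsKFormula k → (e φ).IsKFormula k := fun φ hφ =>
    Formula.isKFormula_iff.2 ⟨hφ, hSk _ (hrepS φ hφ)⟩
  have hΘ : ∀ χ ∈ Θ, χ.IsKFormula k ∧ χ ∈ L' := by
    have he : ∀ φ : Formula n, φ.IsKFormula k → (e φ).IsKFormula k ∧ e φ ∈ L' :=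
      fun φ hφ => ⟨hek φ hφ, hrep φ hφ⟩
    rintro χ ((((⟨p, hp, rfl⟩ | ⟨p, hp, rfl⟩) | ⟨p, hp, rfl⟩) | rfl) | ⟨hs, hsL⟩)
    · exact he _ ⟨hSk _ hp.1, hSk _ hp.2⟩
    · exact he _ (hSk _ hp.2 : p.2.IsKFormula k)
    · exact he _ hp
    · exact he _ trivial
    · exact ⟨hSk _ hs, hsL⟩
  have hmemΘ : ∀ χ, χ ∈ hΘfin.toFinset.toList ↔ χ ∈ Θ := by simp
  refine ⟨.bigAnd hΘfin.toFinset.toList,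
    hL'.bigAnd_mem fun χ hχ => (hΘ χ ((hmemΘ χ).1 hχ)).2,
    Formula.isKFormula_bigAnd.2 fun χ hχ => (hΘ χ ((hmemΘ χ).1 hχ)).1, fun x hx => ?_⟩
  have hxΘ : ∀ χ ∈ Θ, ∀ y, (canonicalFrame L k).relStar x y → χ ∈ y.1 := fun χ hχ y hxy =>
    (y.2.bigAnd_mem_iff hL fun χ hχ => (hΘ χ ((hmemΘ χ).1 hχ)).1).1 (hx y hxy) χ
      ((hmemΘ χ).2 hχ)
  have hxe : ∀ φ : Formula n, φ.IsKFormula k → e φ ∈ Θ → ∀ y,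
      (canonicalFrame L k).relStar x y → (φ ∈ y.1 ↔ rep φ ∈ y.1) := fun φ hφ he y hxy =>
    (y.2.iff_mem_iff hL hφ (hSk _ (hrepS φ hφ))).1 (hxΘ _ he y hxy)
  have key : ∀ φ : Formula n, φ.IsKFormula k → ∃ s ∈ S, Formula.iff φ s ∈ L' ∧
      ∀ y, (canonicalFrame L k).relStar x y → (φ ∈ y.1 ↔ s ∈ y.1) := by
    intro φ
    induction φ with
    | var p =>
      intro hp
      exact ⟨_, hrepS _ hp, hrep _ hp, hxe _ hp (Or.inl (Or.inl (Or.inr ⟨p, hp, rfl⟩)))⟩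
    | bot =>
      intro hb
      exact ⟨_, hrepS _ hb, hrep _ hb, hxe _ hb (Or.inl (Or.inr rfl))⟩
    | imp φ ψ ih₁ ih₂ =>
      rintro ⟨hφ, hψ⟩
      obtain ⟨s, hs, hsL, hsx⟩ := ih₁ hφ
      obtain ⟨t, ht, htL, htx⟩ := ih₂ hψ
      have hst : (Formula.imp s t).IsKFormula k := ⟨hSk s hs, hSk t ht⟩
      refine ⟨_, hrepS _ hst, ?_, fun y hxy => ?_⟩
      · exact hL'.of_eval₂ (hL'.of_eval₂ (χ := .iff (.imp φ ψ) (.imp s t)) hsL htL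
          fun v => by simp; tauto) (hrep _ hst) fun v => by simp; tauto
      · rw [← hxe _ hst (Or.inl (Or.inl (Or.inl (Or.inl ⟨(s, t), ⟨hs, ht⟩, rfl⟩)))) y hxy,
          y.2.imp_mem_iff hL hφ hψ, y.2.imp_mem_iff hL hst.1 hst.2, hsx y hxy, htx y hxy]
    | dia i φ ih =>
      intro hφ
      obtain ⟨s, hs, hsL, hsx⟩ := ih hφ
      have hds : (Formula.dia i s).IsKFormula k := hSk s hs
      refine ⟨_, hrepS _ hds, ?_, fun y hxy => ?_⟩
      · exact hL'.of_eval₂ (hL'.iff_dia_mem i hsL) (hrep _ hds) fun v => by simp; tauto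
      · rw [← hxe _ hds (Or.inl (Or.inl (Or.inl (Or.inr ⟨(i, s), ⟨trivial, hs⟩, rfl⟩)))) y hxy,
          dia_mem_iff hL (Formula.isKFormula_dia.1 hφ), dia_mem_iff hL (hSk s hs)]
        refine exists_congr fun z => and_congr_right fun hz => hsx z (hxy.tail ⟨i, hz⟩)
  intro φ hφL hφ
  obtain ⟨s, hs, hsL, hsx⟩ := key φ hφ
  have hsL' : s ∈ L' := hL'.of_eval₂ hsL hφL fun v => by simp; tauto
  exact (hsx x Relation.ReflTransGen.refl).2
    (hxΘ s (Or.inr ⟨hs, hsL'⟩) x Relation.ReflTransGen.refl)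

/-- If `L'` is a `k`-tabular extension of `L`, then every set of points of the `k`-canonical frame
of `L` that contain the theorems of `L'` is definable by a `k`-formula. -/
theorem exists_mem_iff_of_isKTabular (hL : IsLogic L) (hpre : IsPretransitive L)
    {L' : Set (Formula n)} (hL' : IsLogic L') (htab : IsKTabular L' k)
    (P : Set (canonicalFrame L k).W) (hP : ∀ x ∈ P, ∀ φ ∈ L', φ.IsKFormula k → φ ∈ x.1) :
    ∃ β : Formula n, β.IsKFormula k ∧ ∀ x : (canonicalFrame L k).W, β ∈ x.1 ↔ x ∈ P := by
  classical
  obtain ⟨γ, hγL, hγ, hγx⟩ := exists_axiom_of_isKTabular hL hL' htab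
  obtain ⟨S, hfin, hSk, hS⟩ := htab
  let δ : Set (Formula n) → Formula n := fun T =>
    .bigAnd (hfin.toFinset.toList.map fun s => if s ∈ T then s else .neg s)
  have hδl : ∀ T : Set (Formula n), ∀ χ ∈ hfin.toFinset.toList.map (fun s => if s ∈ T then s else .neg s),
      χ.IsKFormula k := by
    intro T χ hχ
    obtain ⟨s, hs, rfl⟩ := List.mem_map.1 hχ
    have := hSk s (by simpa using hs)
    by_cases h : s ∈ T <;> simpa [h]
  have hδk : ∀ T, (δ T).IsKFormula k := fun T => Formula.isKFormula_bigAnd.2 (hδl T)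
  have hδ : ∀ T (x : (canonicalFrame L k).W), δ T ∈ x.1 ↔ ∀ s ∈ S, (s ∈ x.1 ↔ s ∈ T) := by
    intro T x
    change Formula.bigAnd _ ∈ _ ↔ _
    rw [x.2.bigAnd_mem_iff hL (hδl T)]
    simp only [List.mem_map, Finset.mem_toList, Set.Finite.mem_toFinset, forall_exists_index,
      and_imp, forall_apply_eq_imp_iff₂]
    refine forall₂_congr fun s hs => ?_
    by_cases h : s ∈ T
    · simp [h]
    · simp [h, x.2.neg_mem_iff hL (hSk s hs)]
  have hDfin : ((fun x : (canonicalFrame L k).W => δ (x.1 ∩ S)) '' P).Finite := by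
    refine (hfin.powerset.image δ).subset ?_
    rintro _ ⟨x, _, rfl⟩
    exact ⟨_, Set.inter_subset_right, rfl⟩
  have hbox : (boxStar L γ).IsKFormula k := isKFormula_boxStar L hγ
  have hDk : ∀ χ ∈ hDfin.toFinset.toList, χ.IsKFormula k := by
    intro χ hχ
    obtain ⟨x, _, rfl⟩ : χ ∈ _ '' P := by simpa using hχ
    exact hδk _
  refine ⟨.and (boxStar L γ) (.bigOr hDfin.toFinset.toList),
    Formula.isKFormula_and.2 ⟨hbox, Formula.isKFormula_bigOr.2 hDk⟩, fun x => ?_⟩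
  rw [x.2.and_mem_iff hL hbox (Formula.isKFormula_bigOr.2 hDk), x.2.bigOr_mem_iff hL hDk,
    boxStar_mem_iff hL hpre hγ]
  constructor
  · rintro ⟨hxγ, χ, hχ, hχx⟩
    obtain ⟨y, hy, rfl⟩ : χ ∈ _ '' P := by simpa using hχ
    have htrace : ∀ s ∈ S, (s ∈ x.1 ↔ s ∈ y.1) := fun s hs => by
      simpa [hs] using (hδ _ x).1 hχx s hs
    have hxL := hγx x hxγ
    have hyL := hP y hy
    have hxy : x = y := by
      refine Subtype.ext (x.2.eq_of_subset y.2 fun φ hφy => ?_)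
      have hφ := y.2.isKFormula hφy
      obtain ⟨s, hs, hsL⟩ := hS φ hφ
      have hk := Formula.isKFormula_iff.2 ⟨hφ, hSk s hs⟩
      have h₁ := (x.2.iff_mem_iff hL hφ (hSk s hs)).1 (hxL _ hsL hk)
      have h₂ := (y.2.iff_mem_iff hL hφ (hSk s hs)).1 (hyL _ hsL hk)
      exact h₁.2 ((htrace s hs).2 (h₂.1 hφy))
    exact hxy ▸ hy
  · intro hx
    refine ⟨fun y hxy => mem_of_relStar hL hL' hxy (hP x hx) γ hγL hγ, δ (x.1 ∩ S), ?_, ?_⟩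
    · simpa using ⟨x, hx, rfl⟩
    · exact (hδ _ x).2 fun s hs => by simp [hs]

theorem exists_definesDepth (hL : IsLogic L) (hpre : IsPretransitive L) {h : ℕ}
    (htab : IsKTabular (ofHeight L h) k) : ∃ B : ℕ → Formula n, DefinesDepth L h k B := by
  have : ∀ i, ∃ β : Formula n, i ≤ h → β.IsKFormula k ∧ ∀ x : (canonicalFrame L k).W,
      β ∈ x.1 ↔ (canonicalFrame L k).depth x ≤ (i : ℕ∞) := by
    intro i
    by_cases hi : i ≤ h
    · obtain ⟨β, hβ⟩ := exists_mem_iff_of_isKTabular hL hpre (isLogic_ofHeight L h) htab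
        {x | (canonicalFrame L k).depth x ≤ (i : ℕ∞)}
        fun x hx => (depth_le_iff_ofHeight hL hpre h x).1 (hx.trans (Nat.cast_le.2 hi))
      exact ⟨β, fun _ => hβ⟩
    · exact ⟨.bot, fun h => absurd h hi⟩
  choose B hB using this
  exact ⟨B, hB⟩

/-! ### The translation -/

theorem translation_mem_iff (hL : IsLogic L) (hpre : IsPretransitive L) {h : ℕ}
    {B : ℕ → Formula n} (hB : DefinesDepth L h k B) (hφ : φ.IsKFormula k) :
    translation L h B φ ∈ L ↔ ∀ i ≤ h, ∀ x : (canonicalFrame L k).W,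
      (∀ y, (canonicalFrame L k).relStar x y →
        (∀ z, (canonicalFrame L k).relStar y z → φ ∈ z.1) →
          (canonicalFrame L k).depth y ≤ (i : ℕ∞)) →
        (canonicalFrame L k).depth x ≤ (i : ℕ∞) := by
  have hboxφ : (boxStar L φ).IsKFormula k := isKFormula_boxStar L hφ
  have himp : ∀ i ≤ h, (Formula.imp (boxStar L φ) (B i)).IsKFormula k := fun i hi =>
    ⟨hboxφ, (hB i hi).1⟩
  have hbox : ∀ i ≤ h, (boxStar L (.imp (boxStar L φ) (B i))).IsKFormula k := fun i hi =>
    isKFormula_boxStar L (himp i hi)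
  have hconj : ∀ χ ∈ (List.range (h + 1)).map (fun i =>
      Formula.imp (boxStar L (.imp (boxStar L φ) (B i))) (B i)), χ.IsKFormula k := by
    intro χ hχ
    obtain ⟨i, hi, rfl⟩ := List.mem_map.1 hχ
    have hi' := Nat.lt_succ_iff.1 (List.mem_range.1 hi)
    exact ⟨hbox i hi', (hB i hi').1⟩
  have hmem : ∀ x : (canonicalFrame L k).W, translation L h B φ ∈ x.1 ↔ ∀ i ≤ h,
      (∀ y, (canonicalFrame L k).relStar x y →
        (∀ z, (canonicalFrame L k).relStar y z → φ ∈ z.1) →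
          (canonicalFrame L k).depth y ≤ (i : ℕ∞)) →
        (canonicalFrame L k).depth x ≤ (i : ℕ∞) := by
    intro x
    rw [translation, x.2.bigAnd_mem_iff hL hconj]
    simp only [List.mem_map, List.mem_range, forall_exists_index, and_imp,
      forall_apply_eq_imp_iff₂, Nat.lt_succ_iff]
    refine forall₂_congr fun i hi => ?_
    rw [x.2.imp_mem_iff hL (hbox i hi) (hB i hi).1, boxStar_mem_iff hL hpre (himp i hi),
      (hB i hi).2]
    refine imp_congr_left (forall₂_congr fun y _ => ?_)
    rw [y.2.imp_mem_iff hL hboxφ (hB i hi).1, boxStar_mem_iff hL hpre hφ, (hB i hi).2]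
  have hk : (translation L h B φ).IsKFormula k := Formula.isKFormula_bigAnd.2 hconj
  constructor
  · intro ht i hi x
    exact (hmem x).1 (x.2.mem_of_mem hL hk ht) i hi
  · intro hall
    by_contra ht
    obtain ⟨x, hx, -⟩ := exists_notMem_of_notMem hL hL subset_rfl hk ht
    exact hx ((hmem x).2 fun i hi => hall i hi x)

theorem mem_ofHeight_succ_iff (hL : IsLogic L) (hpre : IsPretransitive L) {h : ℕ}
    {B : ℕ → Formula n} (hB : DefinesDepth L h k B) (hφ : φ.IsKFormula k) :
    φ ∈ ofHeight L (h + 1) ↔ translation L h B φ ∈ L := by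
  rw [translation_mem_iff hL hpre hB hφ]
  constructor
  · intro hmem i hi x hx
    by_contra hdepth
    have hneg : Formula.neg (B i) ∈ x.1 :=
      (x.2.neg_mem_iff hL (hB i hi).1).2 fun hBx => hdepth (((hB i hi).2 x).1 hBx)
    obtain ⟨y, hxy, hBy, hmax⟩ := exists_maximal_mem hL hpre hneg
    have hy : ¬ (canonicalFrame L k).depth y ≤ (i : ℕ∞) := fun hd =>
      (y.2.neg_mem_iff hL (hB i hi).1).1 hBy (((hB i hi).2 y).2 hd)
    have hy' : (canonicalFrame L k).depth y ≤ ((i + 1 : ℕ) : ℕ∞) := by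
      refine (KripkeFrame.depth_le_succ_iff _ y i).2 fun z hyz hzy => ?_
      by_contra hz
      exact hzy (hmax z hyz ((z.2.neg_mem_iff hL (hB i hi).1).2 fun hBz =>
        hz (((hB i hi).2 z).1 hBz)))
    refine hy (hx y hxy fun z hyz => ?_)
    exact mem_of_mem_ofHeight hL hpre
      ((KripkeFrame.depth_mono hyz hy').trans (Nat.cast_le.2 (Nat.succ_le_succ hi))) hφ hmem
  · intro hall
    by_contra hnot
    obtain ⟨x, hφx, hx⟩ := exists_notMem_of_notMem hL (isLogic_ofHeight L (h + 1))
      (subset_ofHeight L (h + 1)) hφ hnot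
    have hdepth := (depth_le_iff_ofHeight hL hpre (h + 1) x).2 hx
    have hstep : ∀ i : ℕ, (canonicalFrame L k).depth x ≤ ((i + 1 : ℕ) : ℕ∞) →
        ∀ y, (canonicalFrame L k).relStar x y →
          (∀ z, (canonicalFrame L k).relStar y z → φ ∈ z.1) →
            (canonicalFrame L k).depth y ≤ (i : ℕ∞) := fun i hi y hxy hy =>
      (KripkeFrame.depth_le_succ_iff _ x i).1 hi y hxy fun hyx => hφx (hy x hyx)
    have hdesc : ∀ i ≤ h + 1, ¬ (canonicalFrame L k).depth x ≤ (i : ℕ∞) := by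
      intro i
      induction i with
      | zero => exact fun _ => KripkeFrame.not_depth_le_zero _ x
      | succ i ih =>
        intro hi hd
        exact ih (by omega) (hall i (by omega) x (hstep i hd))
    exact hdesc (h + 1) le_rfl hdepth

end ModalLogic

theorem mainTheorem1 {n : ℕ} (hn : 0 < n) (L : Set (Formula n)) (hL : IsLogic L)
    (hpre : ModalLogic.IsPretransitive L) (h k : ℕ)
    (htab : ModalLogic.IsKTabular (ModalLogic.ofHeight L h) k) :
    (∃ B : ℕ → Formula n, ModalLogic.DefinesDepth L h k B) ∧
    ∀ B : ℕ → Formula n, ModalLogic.DefinesDepth L h k B →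
      ∀ φ : Formula n, φ.IsKFormula k →
        (φ ∈ ModalLogic.ofHeight L (h + 1) ↔ ModalLogic.translation L h B φ ∈ L) :=
  ⟨ModalLogic.exists_definesDepth hL hpre htab, fun _ hB _ hφ =>
    ModalLogic.mem_ofHeight_succ_iff hL hpre hB hφ⟩
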